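/- Let $n\ge 3$. Let $c:\mathbf R^n\to\mathbf R$ satisfy $c(x)>0$ for all $x$, $c,\,c^{-1}\in L^\infty(\mathbf R^n)$ and $\nabla c\in (L^\infty(\mathbf R^n))^n$. Let $u_0\in H^1(\mathbf R^n)$ and $u_1\in L^2(\mathbf R^n)\cap L^1(\mathbf R^n)$ be real valued, and let $u\in C([0,\infty);H^1(\mathbf R^n))\cap C^1([0,\infty);L^2(\mathbf R^n))$ be the weak solution of $$u_{tt}(t,x)-c(x)^2\Delta u(t,x)=0,\qquad u(0,x)=u_0(x),\quad u_t(0,x)=u_1(x),$$ that is, $u(0)=u_0$, $u_t(0)=u_1$ and, for every $\varphi\in C_c^\infty(\mathbf R^n)$ and $t\ge 0$, $$\frac{d}{dt}\int_{\mathbf R^n}\frac{1}{c(x)^2}u_t(t,x)\varphi(x)\,dx=-\int_{\mathbf R^n}\nabla u(t,x)\cdot\nabla\varphi(x)\,dx .$$ Then for all $t\ge 0$ $$\|u(t,\cdot)\|_{L^2}\le C\,\|c^{-1}\|_{L^\infty}^2\bigl(\|u_1\|_{L^2}+\|u_1\|_{L^1}\bigr)+C\,\|c^{-1}u_0\|_{L^2},$$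 where the constant $C>0$ depends only on $n$ and on an upper bound for $\|c\|_{L^\infty}$; in particular it does not depend on $t$, $u_0$, $u_1$. -/

import Mathlib

open MeasureTheory Set
open scoped ENNReal ContDiff

namespace LipschitzWave

/-- The Euclidean space `ℝⁿ`. -/
abbrev Rn (n : ℕ) : Type := EuclideanSpace ℝ (Fin n)

/-- `L²(ℝⁿ)`, real valued. -/
abbrev L2 (n : ℕ) : Type := Lp ℝ 2 (volume : Measure (Rn n))

/-- `L²(ℝⁿ)ⁿ`, that is, square integrable vector fields on `ℝⁿ`. -/
abbrev L2Vec (n : ℕ) : Type := Lp (Rn n) 2 (volume : Measure (Rn n))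

/-- Test functions: `φ ∈ C_c^∞(ℝⁿ)`. -/
def IsTest {n : ℕ} (φ : Rn n → ℝ) : Prop :=
  ContDiff ℝ ∞ φ ∧ HasCompactSupport φ

/-- The locally integrable vector field `g` is the gradient of the locally integrable function `f`
in the sense of distributions: `∫ f ∇φ = - ∫ φ g` for every test function `φ`
(an identity of vectors, i.e. `∫ f ∂_j φ = - ∫ φ g_j` for each `j`). -/
def HasWeakGradient {n : ℕ} (f : Rn n → ℝ) (g : Rn n → Rn n) : Prop :=
  LocallyIntegrable f volume ∧ LocallyIntegrable g volume ∧
    ∀ φ : Rn n → ℝ, IsTest φ →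
      ∫ x, f x • gradient φ x = - ∫ x, φ x • g x

/-- `f ∈ H¹(ℝⁿ)`: `f ∈ L²` and its distributional gradient is in `L²`. -/
def MemH1 {n : ℕ} (f : Rn n → ℝ) : Prop :=
  MemLp f 2 volume ∧ ∃ g : Rn n → Rn n, MemLp g 2 volume ∧ HasWeakGradient f g

/-- Admissible wave speeds: `c > 0` everywhere, `c, c⁻¹ ∈ L^∞(ℝⁿ)` and
`∇c ∈ L^∞(ℝⁿ)ⁿ` (distributional gradient). -/
structure IsWavespeed {n : ℕ} (c : Rn n → ℝ) : Prop where
  pos : ∀ x, 0 < c x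
  memLp_top : MemLp c ∞ volume
  inv_memLp_top : MemLp (fun x => (c x)⁻¹) ∞ volume
  gradient_memLp_top : ∃ g : Rn n → Rn n, MemLp g ∞ volume ∧ HasWeakGradient c g

/-- `u ∈ C([0,∞); H¹(ℝⁿ)) ∩ C¹([0,∞); L²(ℝⁿ))` is a weak solution of
`u_tt - c(x)² Δu = 0`, `u(0) = u₀`, `u_t(0) = u₁`.

Here `gu t = ∇u(t)` and `ut t = u_t(t)`; these are determined by `u` on `[0,∞)`. Continuity of `u`
with values in `H¹` is continuity of `u` and of `∇u` with values in `L²`. The equation, divided by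
`c²`, is required in its weak form
`d/dt ∫ c⁻² u_t(t) φ dx = - ∫ ∇u(t) · ∇φ dx` for all `t ≥ 0` and all `φ ∈ C_c^∞(ℝⁿ)`
(derivatives in `t` at `t = 0` are one-sided). Values of `u` at negative times are irrelevant. -/
def IsWeakSolution {n : ℕ} (c u₀ u₁ : Rn n → ℝ) (u : ℝ → L2 n) : Prop :=
  ∃ (gu : ℝ → L2Vec n) (ut : ℝ → L2 n),
    ContinuousOn u (Ici 0) ∧
    ContinuousOn gu (Ici 0) ∧
    (∀ t, 0 ≤ t → HasWeakGradient (u t) (gu t)) ∧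
    ContinuousOn ut (Ici 0) ∧
    (∀ t, 0 ≤ t → HasDerivWithinAt u (ut t) (Ici 0) t) ∧
    u 0 =ᵐ[volume] u₀ ∧
    ut 0 =ᵐ[volume] u₁ ∧
    ∀ φ : Rn n → ℝ, IsTest φ → ∀ t, 0 ≤ t →
      HasDerivWithinAt (fun s => ∫ x, (c x)⁻¹ ^ 2 * ut s x * φ x)
        (- ∫ x, inner ℝ (gu t x) (gradient φ x)) (Ici 0) t

end LipschitzWave

/-!
The proof is Morawetz's trick of integrating the equation in time. Put `v(t) = ∫₀ᵗ u`. Then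
`c⁻² v_tt - Δv = c⁻² u₁`, and multiplication by `v_t = u` gives the conservation law
`‖c⁻¹ u(t)‖² + ‖∇v(t)‖² = ‖c⁻¹ u₀‖² + 2 ∫ c⁻² u₁ v(t)`
(`LipschitzWave.exists_primitive_energy_identity`, stated for a pair of Hilbert spaces). Since
`n ≥ 3`, the Sobolev embedding `‖v‖_{2n/(n-2)} ≤ S ‖∇v‖₂` and Hölder's inequality bound the last
integral by a multiple of `‖c⁻¹‖_∞² ‖u₁‖_{2n/(n+2)} ‖∇v(t)‖₂`, where `2n/(n+2) ∈ [1, 2]`, so that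
`‖u₁‖_{2n/(n+2)}` is controlled by `‖u₁‖₁ + ‖u₁‖₂`
(`LipschitzWave.exists_sobolev_pairing_bound`). The factor `‖∇v(t)‖₂` is absorbed by the left side,
and `‖u‖ ≤ ‖c‖_∞ ‖c⁻¹ u‖` finishes the proof.

Both the weak equation and the Sobolev inequality are available for test functions only, whereas they
are applied to `u(t)` and `v(t)`. They are carried over by continuity: all the pairs `(u(t), ∇u(t))`
lie in the closure `LipschitzWave.gradGraph` of the pairs `(φ, ∇φ)` in `L² × (L²)ⁿ`
(`LipschitzWave.HasWeakGradient.mem_gradGraph`, by mollification and cutoff), and so do their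
integrals in time, because this closure is a closed subspace.
-/

namespace LipschitzWave

open Filter Topology

variable {n : ℕ}

/-! ### Mollification in `L²` -/

/-- Translations act continuously on `L²`. -/
theorem exists_translation_close {F : Type*} [NormedAddCommGroup F]
    {f : Rn n → F} (hf : MemLp f 2 volume) {ε : ℝ≥0∞} (hε : 0 < ε) :
    ∃ δ > 0, ∀ y : Rn n, ‖y‖ < δ → eLpNorm (fun x => f (x - y) - f x) 2 volume ≤ ε := by
  let τ : Rn n → C(Rn n, Rn n) := fun y => ⟨fun x => x - y, by fun_prop⟩
  have hτ : ∀ y, MeasurePreserving (τ y) volume volume := fun y =>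
    measurePreserving_sub_right volume y
  have hτc : Continuous τ :=
    ContinuousMap.continuous_of_continuous_uncurry _ (by
      change Continuous fun p : Rn n × Rn n => p.2 - p.1
      fun_prop)
  have hcont : Continuous fun y => Lp.compMeasurePreserving (τ y) (hτ y) (hf.toLp f) :=
    continuous_const.compMeasurePreservingLp hτc hτ (by simp)
  have h0 := EMetric.tendsto_nhds.1 (hcont.tendsto 0) ε hε
  obtain ⟨δ, hδ, h⟩ := Metric.eventually_nhds_iff.1 h0
  refine ⟨δ, hδ, fun y hy => ?_⟩
  have := (h (y := y) (by simpa using hy)).le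
  rw [Lp.edist_def] at this
  refine le_trans (le_of_eq (eLpNorm_congr_ae ?_)) this
  have e1 : ∀ z, Lp.compMeasurePreserving (τ z) (hτ z) (hf.toLp f) =ᵐ[volume]
      fun x => f (x - z) := fun z =>
    (Lp.coeFn_compMeasurePreserving _ (hτ z)).trans
      ((hτ z).quasiMeasurePreserving.ae_eq_comp hf.coeFn_toLp)
  filter_upwards [e1 y, e1 0] with x h1 h2
  rw [Pi.sub_apply, h1, h2, sub_zero]

/-- By Jensen's inequality for the probability density `η`, mollifying by `η` moves `f` in `L²` by no
more than the translations of size at most the radius of `η` do. -/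
theorem eLpNorm_average_translation_le {F : Type*} [NormedAddCommGroup F]
    [NormedSpace ℝ F] [CompleteSpace F]
    {f : Rn n → F} (hf : MemLp f 2 volume) (η : ContDiffBump (0 : Rn n)) {ε : ℝ≥0∞}
    (h : ∀ y : Rn n, ‖y‖ < η.rOut → eLpNorm (fun x => f (x - y) - f x) 2 volume ≤ ε) :
    eLpNorm (fun x => (∫ y, η.normed volume y • f (x - y)) - f x) 2 volume ≤ ε := by
  set w : Rn n → ℝ≥0∞ := fun y => ENNReal.ofReal (η.normed volume y) with hw
  have hwm : Measurable w := η.continuous_normed.measurable.ennreal_ofReal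
  have hw1 : ∫⁻ y, w y = 1 := by
    rw [hw, ← ofReal_integral_eq_lintegral_ofReal η.integrable_normed
      (.of_forall fun x => η.nonneg_normed x), η.integral_normed, ENNReal.ofReal_one]
  have hwtop : ∀ᵐ y ∂(volume : Measure (Rn n)), w y < ⊤ := .of_forall fun y => by simp [hw]
  set ν : Measure (Rn n) := volume.withDensity w with hν
  have : IsProbabilityMeasure ν := ⟨by simp [hν, hw1]⟩
  have hνac : ν ≪ volume := withDensity_absolutelyContinuous _ _
  have hloc : LocallyIntegrable f volume := hf.locallyIntegrable (by norm_num)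
  -- Joint measurability, needed for Tonelli's theorem.
  have hm2 : AEStronglyMeasurable (fun p : Rn n × Rn n => f (p.1 - p.2) - f p.1)
      ((volume : Measure (Rn n)).prod volume) := by
    refine AEStronglyMeasurable.sub ?_ hf.1.comp_fst
    exact hf.1.comp_quasiMeasurePreserving (quasiMeasurePreserving_sub volume volume)
  have hm2' : AEStronglyMeasurable (fun p : Rn n × Rn n => f (p.1 - p.2) - f p.1)
      ((volume : Measure (Rn n)).prod ν) :=
    hm2.mono_ac (Measure.AbsolutelyContinuous.rfl.prod hνac)
  have hint : ∀ x, Integrable (fun y => η.normed volume y • f (x - y)) volume := by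
    intro x
    have := η.hasCompactSupport_normed (μ := volume) |>.convolutionExists_left
      (ContinuousLinearMap.lsmul ℝ ℝ) η.continuous_normed hloc x
    simpa [ConvolutionExistsAt] using this
  have hdiff : ∀ x, (∫ y, η.normed volume y • f (x - y)) - f x
      = ∫ y, (f (x - y) - f x) ∂ν := by
    intro x
    rw [hν, integral_withDensity_eq_integral_toReal_smul hwm hwtop]
    have : ∀ y, (w y).toReal = η.normed volume y := fun y =>
      ENNReal.toReal_ofReal (η.nonneg_normed y)
    simp only [this, smul_sub]
    rw [integral_sub (hint x) (η.integrable_normed.smul_const _), η.integral_normed_smul]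
  have hpt : ∀ᵐ x ∂(volume : Measure (Rn n)),
      ‖(∫ y, η.normed volume y • f (x - y)) - f x‖ₑ ^ (2:ℝ)
        ≤ ∫⁻ y, ‖f (x - y) - f x‖ₑ ^ (2:ℝ) ∂ν := by
    filter_upwards [hm2'.prodMk_left] with x hx
    rw [hdiff]
    have h1 : ‖∫ y, (f (x - y) - f x) ∂ν‖ₑ ≤ eLpNorm (fun y => f (x - y) - f x) 2 ν :=
      (enorm_integral_le_lintegral_enorm _).trans (by
        rw [← eLpNorm_one_eq_lintegral_enorm]
        exact eLpNorm_le_eLpNorm_of_exponent_le (by norm_num) hx)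
    calc _ ≤ (eLpNorm (fun y => f (x - y) - f x) 2 ν) ^ (2:ℝ) := by gcongr
      _ = _ := by
        rw [eLpNorm_eq_lintegral_rpow_enorm_toReal (by norm_num) (by norm_num)]
        simp only [ENNReal.toReal_ofNat]
        rw [← ENNReal.rpow_mul]; norm_num
  rw [eLpNorm_eq_lintegral_rpow_enorm_toReal (by norm_num) (by norm_num)]
  simp only [ENNReal.toReal_ofNat, one_div]
  rw [ENNReal.rpow_inv_le_iff (by norm_num)]
  calc _ ≤ ∫⁻ x, ∫⁻ y, ‖f (x - y) - f x‖ₑ ^ (2:ℝ) ∂ν := lintegral_mono_ae hpt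
    _ = ∫⁻ y, (∫⁻ x, ‖f (x - y) - f x‖ₑ ^ (2:ℝ)) ∂ν :=
        lintegral_lintegral_swap (hm2'.enorm.pow_const _)
    _ ≤ ∫⁻ y, ε ^ (2:ℝ) ∂ν := by
        refine lintegral_mono_ae ?_
        rw [hν, ae_withDensity_iff hwm]
        refine .of_forall fun y hy => ?_
        have hy' : ‖y‖ < η.rOut := by
          have : y ∈ Function.support (η.normed volume) := by
            intro h0; apply hy; simp [hw, h0]
          rw [η.support_normed_eq] at this
          simpa using this
        have := h y hy'
        rw [eLpNorm_eq_lintegral_rpow_enorm_toReal (by norm_num) (by norm_num)] at this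
        simp only [ENNReal.toReal_ofNat, one_div] at this
        rwa [ENNReal.rpow_inv_le_iff (by norm_num)] at this
    _ = ε ^ (2:ℝ) := by simp

/-! ### Density of test functions in `H¹` -/

theorem _root_.HasCompactSupport.gradient {φ : Rn n → ℝ} (h : HasCompactSupport φ) :
    HasCompactSupport (gradient φ) :=
  (h.fderiv ℝ).comp_left (g := (InnerProductSpace.toDual ℝ (Rn n)).symm) (map_zero _)

theorem _root_.ContDiff.continuous_gradient {φ : Rn n → ℝ} (h : ContDiff ℝ ∞ φ) :
    Continuous (gradient φ) :=
  (InnerProductSpace.toDual ℝ (Rn n)).symm.continuous.comp (h.continuous_fderiv (by simp))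

theorem IsTest.memLp {φ : Rn n → ℝ} (h : IsTest φ) (p : ℝ≥0∞) : MemLp φ p volume :=
  h.1.continuous.memLp_of_hasCompactSupport h.2

theorem IsTest.memLp_gradient {φ : Rn n → ℝ} (h : IsTest φ) (p : ℝ≥0∞) :
    MemLp (gradient φ) p volume :=
  h.1.continuous_gradient.memLp_of_hasCompactSupport h.2.gradient

theorem norm_gradient (φ : Rn n → ℝ) (x : Rn n) : ‖gradient φ x‖ = ‖fderiv ℝ φ x‖ :=
  (InnerProductSpace.toDual ℝ (Rn n)).symm.norm_map _

/-- The pairs `(φ, ∇φ)`, `φ` a test function, as a subspace of `L² × (L²)ⁿ`. -/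
noncomputable def testPairs (n : ℕ) : Submodule ℝ (L2 n × L2Vec n) where
  carrier := {p | ∃ φ : Rn n → ℝ, IsTest φ ∧ p.1 =ᵐ[volume] φ ∧ p.2 =ᵐ[volume] gradient φ}
  zero_mem' := by
    refine ⟨0, ⟨contDiff_const, HasCompactSupport.zero⟩, Lp.coeFn_zero _ _ _, ?_⟩
    have : gradient (0 : Rn n → ℝ) = 0 := by
      funext x; exact gradient_const x 0
    rw [this]; exact Lp.coeFn_zero _ _ _
  add_mem' := by
    rintro p q ⟨φ, hφ, h1, h2⟩ ⟨ψ, hψ, h3, h4⟩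
    refine ⟨φ + ψ, ⟨hφ.1.add hψ.1, hφ.2.add hψ.2⟩,
      (Lp.coeFn_add _ _).trans (h1.add h3), (Lp.coeFn_add _ _).trans ?_⟩
    filter_upwards [h2, h4] with x hx hy
    have e := fderiv_add (hφ.1.differentiable (by simp) x) (hψ.1.differentiable (by simp) x)
    rw [Pi.add_apply, hx, hy, gradient, gradient, gradient, e, map_add]
  smul_mem' := by
    rintro a p ⟨φ, hφ, h1, h2⟩
    refine ⟨a • φ, ⟨contDiff_const.smul hφ.1, hφ.2.smul_left (f := fun _ => a)⟩,
      (Lp.coeFn_smul _ _).trans (h1.const_smul a), (Lp.coeFn_smul _ _).trans ?_⟩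
    filter_upwards [h2] with x hx
    have e := fderiv_const_smul (hφ.1.differentiable (by simp) x) a
    rw [Pi.smul_apply, hx, gradient, gradient, e, map_smul]

/-- The graph of the gradient on `H¹(ℝⁿ)`, encoded as the closure of the pairs `(φ, ∇φ)`, `φ` a test
function, in `L² × (L²)ⁿ`. It contains every pair in `L² × (L²)ⁿ` linked by `HasWeakGradient`. -/
noncomputable def gradGraph (n : ℕ) : Submodule ℝ (L2 n × L2Vec n) :=
  (testPairs n).topologicalClosure

/-- Cutoffs with values in `[0, 1]` that are eventually `1` at each point converge strongly to the
identity on `L²`, by dominated convergence. -/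
theorem tendsto_eLpNorm_cutoff {F : Type*} [NormedAddCommGroup F] [NormedSpace ℝ F]
    {f : Rn n → F} (hf : MemLp f 2 volume) {χ : ℕ → Rn n → ℝ} (hc : ∀ k, Continuous (χ k))
    (h0 : ∀ k x, 0 ≤ χ k x) (h1 : ∀ k x, χ k x ≤ 1)
    (hlim : ∀ x, ∀ᶠ k in atTop, χ k x = 1) :
    Tendsto (fun k => eLpNorm ((fun x => χ k x • f x) - f) 2 volume) atTop (𝓝 0) := by
  have key : Tendsto (fun k => ∫⁻ x, ‖χ k x • f x - f x‖ₑ ^ (2:ℝ)) atTop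
      (𝓝 (∫⁻ _ : Rn n, 0)) := by
    refine tendsto_lintegral_of_dominated_convergence' (fun x => ‖f x‖ₑ ^ (2:ℝ)) ?_ ?_ ?_ ?_
    · intro k
      exact ((((hc k).aestronglyMeasurable.smul hf.1).sub hf.1).enorm.pow_const _)
    · intro k
      refine .of_forall fun x => ?_
      dsimp only
      gcongr
      rw [show χ k x • f x - f x = (χ k x - 1) • f x by rw [sub_smul, one_smul], enorm_smul]
      refine mul_le_of_le_one_left (zero_le) ?_
      rw [Real.enorm_eq_ofReal_abs, ENNReal.ofReal_le_one, abs_le]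
      constructor <;> linarith [h0 k x, h1 k x]
    · have := hf.2
      rw [eLpNorm_lt_top_iff_lintegral_rpow_enorm_lt_top (by norm_num) (by norm_num)] at this
      simpa using this.ne
    · refine .of_forall fun x => ?_
      refine tendsto_const_nhds.congr' ?_
      filter_upwards [hlim x] with k hk
      simp [hk]
  rw [lintegral_zero] at key
  have := ((ENNReal.continuous_rpow_const (y := (2:ℝ)⁻¹)).tendsto 0).comp key
  rw [ENNReal.zero_rpow_of_pos (by norm_num)] at this
  refine this.congr fun k => ?_
  rw [eLpNorm_eq_lintegral_rpow_enorm_toReal (by norm_num) (by norm_num)]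
  simp

/-- A smooth function of class `H¹` is approximated by its products with the cutoffs
`x ↦ η (x / (k + 1))`, whose gradients are `O(1 / k)`. -/
theorem smooth_mem_gradGraph {f : Rn n → ℝ} (hf : ContDiff ℝ ∞ f) (h : MemLp f 2 volume)
    (h' : MemLp (gradient f) 2 volume) : (h.toLp f, h'.toLp (gradient f)) ∈ gradGraph n := by
  let η : ContDiffBump (0 : Rn n) := ⟨1, 2, by norm_num, by norm_num⟩
  let χ : ℕ → Rn n → ℝ := fun k x => η (((k : ℝ) + 1)⁻¹ • x)
  have hχs : ∀ k, ContDiff ℝ ∞ (χ k) := fun k =>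
    η.contDiff.comp (contDiff_const_smul _)
  have hχc : ∀ k, HasCompactSupport (χ k) := fun k =>
    η.hasCompactSupport.comp_smul (by positivity)
  obtain ⟨C, hC⟩ : ∃ C, ∀ x, ‖fderiv ℝ η x‖ ≤ C :=
    (η.contDiff (n := 1)).continuous_fderiv (by simp) |>.bounded_above_of_compact_support
      (η.hasCompactSupport.fderiv ℝ)
  have hχd : ∀ k x, ‖gradient (χ k) x‖ ≤ C * ((k : ℝ) + 1)⁻¹ := by
    intro k x
    rw [norm_gradient]
    have e : fderiv ℝ (χ k) x = ((k : ℝ) + 1)⁻¹ • fderiv ℝ η (((k : ℝ) + 1)⁻¹ • x) :=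
      fderiv_comp_smul _
    rw [e, norm_smul, Real.norm_of_nonneg (by positivity), mul_comm]
    gcongr
    exact hC _
  have hlim : ∀ x, ∀ᶠ k in atTop, χ k x = 1 := by
    intro x
    filter_upwards [eventually_ge_atTop ⌈‖x‖⌉₊] with k hk
    apply η.one_of_mem_closedBall
    have : ‖x‖ ≤ k := (Nat.le_ceil _).trans (by exact_mod_cast hk)
    rw [mem_closedBall_zero_iff, norm_smul, Real.norm_of_nonneg (by positivity)]
    change _ ≤ (1:ℝ)
    rw [inv_mul_le_iff₀ (by positivity)]
    linarith
  have hφ : ∀ k, IsTest (fun x => χ k x • f x) := fun k =>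
    ⟨(hχs k).smul hf, (hχc k).smul_right⟩
  have hgrad : ∀ k, gradient (fun x => χ k x • f x)
      = fun x => χ k x • gradient f x + f x • gradient (χ k) x := by
    intro k
    funext x
    have e := fderiv_fun_smul ((hχs k).differentiable (by simp) x) (hf.differentiable (by simp) x)
    rw [gradient, e, gradient, gradient, map_add, map_smul]
    congr 1
    rw [← map_smul]
    congr 1
    ext w
    simp [mul_comm]
  have hmem : ∀ k, ((hφ k).memLp 2 |>.toLp _, (hφ k).memLp_gradient 2 |>.toLp _) ∈ testPairs n :=
    fun k => ⟨_, hφ k, MemLp.coeFn_toLp ((hφ k).memLp 2),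
      MemLp.coeFn_toLp ((hφ k).memLp_gradient 2)⟩
  refine mem_closure_of_tendsto (b := atTop) (Tendsto.prodMk_nhds ?_ ?_) (.of_forall hmem)
  · rw [Lp.tendsto_Lp_iff_tendsto_eLpNorm'']
    exact tendsto_eLpNorm_cutoff h (fun k => (hχs k).continuous) (fun _ _ => η.nonneg)
      (fun _ _ => η.le_one) hlim
  · rw [Lp.tendsto_Lp_iff_tendsto_eLpNorm'']
    have t1 := tendsto_eLpNorm_cutoff h' (fun k => (hχs k).continuous) (fun _ _ => η.nonneg)
      (fun _ _ => η.le_one) hlim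
    have t2 : Tendsto (fun k : ℕ => ENNReal.ofReal (C * ((k : ℝ) + 1)⁻¹) * eLpNorm f 2 volume)
        atTop (𝓝 0) := by
      have a : Tendsto (fun k : ℕ => C * ((k : ℝ) + 1)⁻¹) atTop (𝓝 0) := by
        have := (tendsto_one_div_add_atTop_nhds_zero_nat (𝕜 := ℝ)).const_mul C
        simpa using this
      have b := ENNReal.Tendsto.mul_const (b := eLpNorm f 2 volume) (ENNReal.tendsto_ofReal a)
        (Or.inr h.2.ne)
      simpa using b
    have t3 := t1.add t2
    rw [add_zero] at t3
    refine tendsto_of_tendsto_of_tendsto_of_le_of_le tendsto_const_nhds t3 (fun _ => zero_le)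
      fun k => ?_
    rw [hgrad]
    have e : (fun x => χ k x • gradient f x + f x • gradient (χ k) x) - gradient f
        = ((fun x => χ k x • gradient f x) - gradient f) + fun x => f x • gradient (χ k) x := by
      funext x; simp; abel
    dsimp only
    rw [e]
    have m1 : AEStronglyMeasurable ((fun x => χ k x • gradient f x) - gradient f) volume :=
      (((hχs k).continuous.smul hf.continuous_gradient).sub
        hf.continuous_gradient).aestronglyMeasurable
    have m2 : AEStronglyMeasurable (fun x => f x • gradient (χ k) x) volume :=
      (hf.continuous.smul (hχs k).continuous_gradient).aestronglyMeasurable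
    refine (eLpNorm_add_le m1 m2 (by norm_num)).trans ?_
    gcongr
    refine eLpNorm_le_mul_eLpNorm_of_ae_le_mul (.of_forall fun x => ?_) 2
    rw [norm_smul, mul_comm]
    gcongr
    exact hχd k x

/-- The mollification of `f` is differentiable, with gradient the mollification of the weak
gradient. -/
theorem HasWeakGradient.hasGradientAt_mollify {f : Rn n → ℝ} {g : Rn n → Rn n}
    (h : HasWeakGradient f g) (η : ContDiffBump (0 : Rn n)) (x : Rn n) :
    HasGradientAt (fun x => ∫ y, η.normed volume y • f (x - y))
      (∫ y, η.normed volume y • g (x - y)) x := by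
  set ρ := η.normed volume with hρ
  have hρs : ∀ m : ℕ∞, ContDiff ℝ m ρ := fun m => η.contDiff_normed
  have hρc : HasCompactSupport ρ := η.hasCompactSupport_normed
  have hd := hρc.hasFDerivAt_convolution_left (ContinuousLinearMap.lsmul ℝ ℝ) (μ := volume)
    (hρs 1) h.1 x
  rw [hasGradientAt_iff_hasFDerivAt]
  refine hd.congr_fderiv ?_
  -- The weak gradient is tested with `y ↦ ρ (x - y)`; the reflection supplies the sign that cancels
  -- the one in the definition of the weak gradient.
  have hφ : IsTest (fun y => ρ (x - y)) :=
    ⟨η.contDiff_normed.comp (contDiff_const.sub contDiff_id),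
      hρc.comp_homeomorph (Homeomorph.subLeft x)⟩
  have hgr : ∀ y, gradient (fun y => ρ (x - y)) y = - gradient ρ (x - y) := by
    intro y
    have e := (((hρs 1).differentiable (by simp) (x - y)).hasFDerivAt.comp y
      ((hasFDerivAt_id y).const_sub x)).fderiv
    simp only [ContinuousLinearMap.comp_neg, ContinuousLinearMap.comp_id] at e
    rw [gradient, gradient, ← map_neg]
    exact congrArg _ e
  have hw := h.2.2 _ hφ
  simp only [hgr, smul_neg, integral_neg, neg_inj] at hw
  have hsw : ∫ y, ρ y • g (x - y) = ∫ y, ρ (x - y) • g y := by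
    have := convolution_eq_swap (f := ρ) (g := g) (x := x) (μ := volume)
      (L := ContinuousLinearMap.lsmul ℝ ℝ)
    simpa [convolution_def] using this
  rw [hsw, ← hw, convolution_eq_swap]
  have hi : Integrable (fun y => f y • gradient ρ (x - y)) volume := by
    have c1 : HasCompactSupport (fun y => gradient ρ (x - y)) :=
      hρc.gradient.comp_homeomorph (Homeomorph.subLeft x)
    have c2 : Continuous (fun y => gradient ρ (x - y)) :=
      (η.contDiff_normed.continuous_gradient).comp (by fun_prop)
    exact h.1.integrable_smul_right_of_hasCompactSupport c2 c1
  have := (InnerProductSpace.toDual ℝ (Rn n)).toContinuousLinearEquiv.toContinuousLinearMap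
    |>.integral_comp_comm hi
  refine Eq.trans ?_ this
  congr 1
  funext y
  ext w
  simp [mul_comm]

/-- Test functions are dense in `H¹(ℝⁿ)`: a fine mollification of `v` is smooth, of class `H¹`, and
close to `v` together with its gradient. -/
theorem HasWeakGradient.mem_gradGraph {v : L2 n} {g : L2Vec n} (h : HasWeakGradient v g) :
    (v, g) ∈ gradGraph n := by
  have hcl : IsClosed (gradGraph n : Set (L2 n × L2Vec n)) :=
    (testPairs n).isClosed_topologicalClosure
  change (v, g) ∈ (gradGraph n : Set (L2 n × L2Vec n))
  rw [← hcl.closure_eq, EMetric.mem_closure_iff]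
  intro ε hε
  obtain ⟨ε', hε', hlt⟩ := exists_between hε
  obtain ⟨δ₁, hδ₁, h₁⟩ := exists_translation_close (Lp.memLp v) hε'
  obtain ⟨δ₂, hδ₂, h₂⟩ := exists_translation_close (Lp.memLp g) hε'
  let η : ContDiffBump (0 : Rn n) := ⟨min δ₁ δ₂ / 2, min δ₁ δ₂,
    by positivity, half_lt_self (by positivity)⟩
  have e₁ := eLpNorm_average_translation_le (Lp.memLp v) η
    fun y hy => h₁ y (lt_of_lt_of_le hy (min_le_left _ _))
  have e₂ := eLpNorm_average_translation_le (Lp.memLp g) η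
    fun y hy => h₂ y (lt_of_lt_of_le hy (min_le_right _ _))
  set V : Rn n → ℝ := fun x => ∫ y, η.normed volume y • v (x - y) with hV
  set G : Rn n → Rn n := fun x => ∫ y, η.normed volume y • g (x - y) with hG
  have hVs : ContDiff ℝ ∞ V := by
    have := η.hasCompactSupport_normed (μ := volume) |>.contDiff_convolution_left
      (n := ⊤) (ContinuousLinearMap.lsmul ℝ ℝ) (μ := volume) η.contDiff_normed h.1
    exact this
  have hgr : gradient V = G := gradient_eq fun x => h.hasGradientAt_mollify η x
  have hGc : Continuous G := hgr ▸ hVs.continuous_gradient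
  have fin : ε' < ⊤ := hlt.trans_le le_top
  have hVm : MemLp V 2 volume := by
    have : MemLp (fun x => V x - v x) 2 volume :=
      ⟨hVs.continuous.aestronglyMeasurable.sub (Lp.memLp v).1, e₁.trans_lt fin⟩
    convert! this.add (Lp.memLp v) using 1
    funext x; simp
  have hGm : MemLp G 2 volume := by
    have : MemLp (fun x => G x - g x) 2 volume :=
      ⟨hGc.aestronglyMeasurable.sub (Lp.memLp g).1, e₂.trans_lt fin⟩
    convert! this.add (Lp.memLp g) using 1
    funext x; simp
  clear_value G
  subst hgr
  refine ⟨_, smooth_mem_gradGraph hVs hVm hGm, ?_⟩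
  rw [edist_comm]
  refine lt_of_le_of_lt ?_ hlt
  rw [Prod.edist_eq]
  refine max_le ?_ ?_
  · rw [Lp.edist_def]
    refine le_trans (le_of_eq (eLpNorm_congr_ae ?_)) e₁
    exact hVm.coeFn_toLp.sub (EventuallyEq.refl _ _)
  · rw [Lp.edist_def]
    refine le_trans (le_of_eq (eLpNorm_congr_ae ?_)) e₂
    filter_upwards [hGm.coeFn_toLp] with x hx
    rw [Pi.sub_apply, hx, ← congrFun hG x]

/-! ### The energy identity for the primitive in time -/

/-- The conservation law for `p = ∫₀ᵗ (u, ∇u)`, in abstract form: `D` plays the role of the pairs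
`(φ, ∇φ)` and `T` that of multiplication by `c⁻²`. The weak equation, integrated in time, reads
`⟪T (u_t(s)), q.1⟫ + ⟪p(s).2, q.2⟫ = ⟪T (u_t(0)), q.1⟫`; it extends to `q` in the closure of `D` and
there it is tested with `q = (u(s), ∇u(s))`. -/
theorem exists_primitive_energy_identity {H H' : Type*} [NormedAddCommGroup H]
    [InnerProductSpace ℝ H] [CompleteSpace H] [NormedAddCommGroup H'] [InnerProductSpace ℝ H']
    [CompleteSpace H'] (D : Submodule ℝ (H × H')) (T : H →L[ℝ] H)
    (hT : ∀ f g, inner ℝ (T f) g = inner ℝ (T g) f) {u ut : ℝ → H} {gu : ℝ → H'}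
    (hgu : ContinuousOn gu (Ici 0))
    (hut : ∀ t, 0 ≤ t → HasDerivWithinAt u (ut t) (Ici 0) t)
    (hmem : ∀ t, 0 ≤ t → (u t, gu t) ∈ D.topologicalClosure)
    (hweak : ∀ q ∈ D, ∀ t, 0 ≤ t → HasDerivWithinAt (fun s => inner ℝ (T (ut s)) q.1)
      (-inner ℝ (gu t) q.2) (Ici 0) t) {t : ℝ} (ht : 0 ≤ t) :
    ∃ p ∈ D.topologicalClosure, inner ℝ (T (u t)) (u t) + ‖p.2‖ ^ 2
      = inner ℝ (T (u 0)) (u 0) + 2 * inner ℝ (T (ut 0)) p.1 := by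
  set K := D.topologicalClosure with hK
  have hKc : IsClosed (K : Set (H × H')) := D.isClosed_topologicalClosure
  have : CompleteSpace K := hKc.completeSpace_coe
  have hu : ContinuousOn u (Ici 0) := fun s hs => (hut s hs).continuousWithinAt
  -- The pair `(u, ∇u)`, made continuous on all of `ℝ` by freezing it at negative times. Integrating
  -- in the complete space `K` keeps the primitive in `K`.
  let U : ℝ → K := fun s => ⟨(u (max s 0), gu (max s 0)), hmem _ (le_max_right _ _)⟩
  have hmax : Continuous fun s : ℝ => max s 0 := by fun_prop
  have hU : Continuous U := Continuous.subtype_mk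
    ((hu.comp_continuous hmax fun s => mem_Ici.2 (le_max_right s 0)).prodMk
      (hgu.comp_continuous hmax fun s => mem_Ici.2 (le_max_right s 0))) _
  let P : ℝ → H × H' := fun s => ((∫ r in (0:ℝ)..s, U r : K) : H × H')
  have hPmem : ∀ s, P s ∈ K := fun s => Subtype.property _
  have hP0 : P 0 = 0 := by simp [P]
  have hP : ∀ s, 0 ≤ s → HasDerivAt P (u s, gu s) s := by
    intro s hs
    have h1 := K.subtypeL.hasFDerivAt.comp_hasDerivAt s (hU.integral_hasStrictDerivAt 0 s).hasDerivAt
    have h2 : K.subtypeL (U s) = (u s, gu s) := by simp [U, max_eq_left hs]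
    rw [h2] at h1
    exact h1
  have hP1 : ∀ s, 0 ≤ s → HasDerivAt (fun s => (P s).1) (u s) s := fun s hs =>
    (ContinuousLinearMap.fst ℝ H H').hasFDerivAt.comp_hasDerivAt s (hP s hs)
  have hP2 : ∀ s, 0 ≤ s → HasDerivAt (fun s => (P s).2) (gu s) s := fun s hs =>
    (ContinuousLinearMap.snd ℝ H H').hasFDerivAt.comp_hasDerivAt s (hP s hs)
  have hconst : ∀ f : ℝ → ℝ, (∀ s, 0 ≤ s → HasDerivWithinAt f 0 (Ici 0) s) →
      ∀ s, 0 ≤ s → f s = f 0 := by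
    intro f hf s hs
    exact constant_of_has_deriv_right_zero
      (fun r hr => (hf r hr.1).continuousWithinAt.mono fun _ h => h.1)
      (fun r hr => (hf r hr.1).mono (Ici_subset_Ici.2 hr.1)) s ⟨hs, le_rfl⟩
  -- The weak equation integrated in time, first on `D`, then on its closure.
  have hint : ∀ s, 0 ≤ s → ∀ q ∈ K,
      inner ℝ (T (ut s)) q.1 + inner ℝ (P s).2 q.2 = inner ℝ (T (ut 0)) q.1 := by
    intro s hs q hq
    have hcl : IsClosed {q : H × H' | inner ℝ (T (ut s)) q.1 + inner ℝ (P s).2 q.2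
        = inner ℝ (T (ut 0)) q.1} := isClosed_eq (by fun_prop) (by fun_prop)
    refine closure_minimal (s := (D : Set (H × H'))) ?_ hcl hq
    intro q hq
    have := hconst (fun s => inner ℝ (T (ut s)) q.1 + inner ℝ (P s).2 q.2) (fun r hr => by
      have h1 := (hweak q hq r hr).add
        ((hP2 r hr).hasDerivWithinAt.inner ℝ (hasDerivWithinAt_const r (Ici 0) q.2))
      convert! h1 using 1
      simp) s hs
    simpa [hP0] using this
  refine ⟨P t, hPmem t, ?_⟩
  have := hconst (fun s => inner ℝ (T (u s)) (u s) + inner ℝ (P s).2 (P s).2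
      - 2 * inner ℝ (T (ut 0)) (P s).1) (fun s hs => by
    have h1 := ((T.hasFDerivAt.comp_hasDerivWithinAt s (hut s hs)).inner ℝ (hut s hs)).add
      ((hP2 s hs).hasDerivWithinAt.inner ℝ (hP2 s hs).hasDerivWithinAt (s := Ici 0)) |>.sub
      (((hasDerivWithinAt_const s (Ici 0) (T (ut 0))).inner ℝ
        (hP1 s hs).hasDerivWithinAt).const_mul 2)
    convert! h1 using 1
    have h2 := hint s hs _ (hmem s hs)
    have h3 := hT (u s) (ut s)
    have h4 := real_inner_comm (gu s) (P s).2
    simp only [inner_zero_left, add_zero, Function.comp_apply] at h2 ⊢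
    linarith) t ht
  simp only [hP0, Prod.fst_zero, Prod.snd_zero, inner_zero_right, real_inner_self_eq_norm_sq] at this
  linarith

/-! ### The Sobolev inequality in dual form -/

theorem eLpNorm_le_two_of_le_one {α F : Type*} [MeasurableSpace α] {μ : Measure α}
    [NormedAddCommGroup F] {w : α → F} (hw : AEStronglyMeasurable w μ) {q : ℝ} (hq1 : 1 ≤ q)
    (hq2 : q ≤ 2) (h1 : eLpNorm w 1 μ ≤ 1) (h2 : eLpNorm w 2 μ ≤ 1) :
    eLpNorm w (ENNReal.ofReal q) μ ≤ 2 := by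
  have hq0 : 0 < q := by linarith
  rw [eLpNorm_one_eq_lintegral_enorm] at h1
  have h2' : ∫⁻ x, ‖w x‖ₑ ^ (2:ℝ) ∂μ ≤ 1 := by
    rw [eLpNorm_eq_lintegral_rpow_enorm_toReal (by norm_num) (by norm_num)] at h2
    simp only [ENNReal.toReal_ofNat, one_div] at h2
    rw [ENNReal.rpow_inv_le_iff (by norm_num)] at h2
    simpa using h2
  have hle : ∫⁻ x, ‖w x‖ₑ ^ q ∂μ ≤ 2 := calc
    _ ≤ ∫⁻ x, (‖w x‖ₑ + ‖w x‖ₑ ^ (2:ℝ)) ∂μ := by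
        refine lintegral_mono fun x => ?_
        rcases le_total ‖w x‖ₑ 1 with h | h
        · refine le_trans ?_ le_self_add
          simpa using ENNReal.rpow_le_rpow_of_exponent_ge h hq1
        · exact le_trans (ENNReal.rpow_le_rpow_of_exponent_le h hq2) le_add_self
    _ = ∫⁻ x, ‖w x‖ₑ ∂μ + ∫⁻ x, ‖w x‖ₑ ^ (2:ℝ) ∂μ := lintegral_add_left' hw.enorm _
    _ ≤ 1 + 1 := add_le_add h1 h2'
    _ = 2 := one_add_one_eq_two
  rw [eLpNorm_eq_lintegral_rpow_enorm_toReal (by simpa using hq0) (by simp),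
    ENNReal.toReal_ofReal hq0.le, one_div, ENNReal.rpow_inv_le_iff hq0]
  refine hle.trans ?_
  simpa using ENNReal.rpow_le_rpow_of_exponent_le (x := 2) (by norm_num) hq1

/-- Interpolation between `L¹` and `L²`, reduced by homogeneity to norms at most `1`, where
`|w|^q ≤ |w| + |w|²` suffices. -/
theorem eLpNorm_le_two_mul_add {α F : Type*} [MeasurableSpace α] {μ : Measure α}
    [NormedAddCommGroup F] [NormedSpace ℝ F] {w : α → F} {q : ℝ} (hq1 : 1 ≤ q)
    (hq2 : q ≤ 2) (h1 : MemLp w 1 μ) (h2 : MemLp w 2 μ) :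
    eLpNorm w (ENNReal.ofReal q) μ ≤ 2 * (eLpNorm w 2 μ + eLpNorm w 1 μ) := by
  set N := eLpNorm w 2 μ + eLpNorm w 1 μ with hN
  have hNtop : N ≠ ⊤ := ENNReal.add_ne_top.2 ⟨h2.2.ne, h1.2.ne⟩
  rcases eq_or_ne N 0 with h0 | h0
  · have : w =ᵐ[μ] 0 := (eLpNorm_eq_zero_iff h1.1 (by norm_num)).1 (add_eq_zero.1 h0).2
    rw [eLpNorm_congr_ae this]; simp
  have hr : 0 < N.toReal := ENNReal.toReal_pos h0 hNtop
  have he : ‖N.toReal⁻¹‖ₑ = N⁻¹ := by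
    rw [enorm_inv hr.ne', Real.enorm_of_nonneg hr.le, ENNReal.ofReal_toReal hNtop]
  have key := eLpNorm_le_two_of_le_one (h1.1.const_smul N.toReal⁻¹) hq1 hq2
    (by rw [eLpNorm_const_smul, he, mul_comm, ← div_eq_mul_inv]
        exact ENNReal.div_le_of_le_mul (by rw [one_mul]; exact le_add_self))
    (by rw [eLpNorm_const_smul, he, mul_comm, ← div_eq_mul_inv]
        exact ENNReal.div_le_of_le_mul (by rw [one_mul]; exact le_self_add))
  rw [eLpNorm_const_smul, he, mul_comm, ← div_eq_mul_inv] at key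
  exact (ENNReal.div_le_iff h0 hNtop).1 key

theorem eLpNorm_mul_le_of_holderConjugate {α : Type*} [MeasurableSpace α] {μ : Measure α}
    {w φ : α → ℝ} (hw : AEStronglyMeasurable w μ) (hφ : AEStronglyMeasurable φ μ) {q r : ℝ}
    (h : q.HolderConjugate r) :
    eLpNorm (fun x => w x • φ x) 1 μ
      ≤ eLpNorm w (ENNReal.ofReal q) μ * eLpNorm φ (ENNReal.ofReal r) μ :=
  have := h.ennrealOfReal
  eLpNorm_smul_le_mul_eLpNorm (f := φ) (φ := w) hφ hw

/-- Hölder's inequality with the Sobolev exponent `2n/(n-2)` and its conjugate `2n/(n+2) ∈ [1, 2]`,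
followed by the Gagliardo–Nirenberg–Sobolev inequality. -/
theorem exists_sobolev_eLpNorm_mul_le (hn : 3 ≤ n) : ∃ A : NNReal,
    ∀ w φ : Rn n → ℝ, MemLp w 1 volume → MemLp w 2 volume → IsTest φ →
      eLpNorm (fun x => w x • φ x) 1 volume
        ≤ 2 * (eLpNorm w 2 volume + eLpNorm w 1 volume) *
          (A * eLpNorm (gradient φ) 2 volume) := by
  have hn' : (3:ℝ) ≤ n := by exact_mod_cast hn
  set r : ℝ := 2 * n / (n - 2) with hr
  set q : ℝ := 2 * n / (n + 2) with hq
  have hr0 : 0 < r := div_pos (by linarith) (by linarith)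
  have hq1 : 1 < q := by rw [hq, lt_div_iff₀ (by linarith)]; linarith
  have hq2 : q ≤ 2 := by rw [hq, div_le_iff₀ (by linarith)]; linarith
  have hrinv : r⁻¹ = 2⁻¹ - (n:ℝ)⁻¹ := by
    have h1 : (n:ℝ) ≠ 0 := by linarith
    rw [hr, inv_div]; field_simp
  have hconj : q.HolderConjugate r := by
    rw [Real.holderConjugate_iff]
    refine ⟨hq1, ?_⟩
    have h1 : (n:ℝ) ≠ 0 := by linarith
    rw [hrinv, hq, inv_div]; field_simp; ring
  refine ⟨eLpNormLESNormFDerivOfEqInnerConst (volume : Measure (Rn n)) ((2 : NNReal) : ℝ),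
    fun w φ h1 h2 hφ => ?_⟩
  have hsob : eLpNorm φ ((r.toNNReal : NNReal) : ℝ≥0∞) volume ≤
      (eLpNormLESNormFDerivOfEqInnerConst (volume : Measure (Rn n)) ((2 : NNReal) : ℝ) : ℝ≥0∞)
        * eLpNorm (fderiv ℝ φ) ((2 : NNReal) : ℝ≥0∞) volume :=
    eLpNorm_le_eLpNorm_fderiv_of_eq_inner (volume : Measure (Rn n))
      (hφ.1.of_le (by simp)) hφ.2 (p := 2) (p' := r.toNNReal) (by norm_num)
      (by rw [finrank_euclideanSpace_fin]; omega)
      (by rw [Real.coe_toNNReal _ hr0.le, hrinv, finrank_euclideanSpace_fin]; rfl)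
  have hgrad : eLpNorm (fderiv ℝ φ) 2 volume = eLpNorm (gradient φ) 2 volume :=
    eLpNorm_congr_norm_ae (.of_forall fun x => (norm_gradient φ x).symm)
  rw [ENNReal.coe_ofNat, hgrad] at hsob
  have hhol : eLpNorm (fun x => w x • φ x) 1 volume
      ≤ eLpNorm w (ENNReal.ofReal q) volume * eLpNorm φ (ENNReal.ofReal r) volume :=
    eLpNorm_mul_le_of_holderConjugate h1.1 hφ.1.continuous.aestronglyMeasurable hconj
  exact hhol.trans (mul_le_mul' (eLpNorm_le_two_mul_add hq1.le hq2 h1 h2) hsob)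

/-- Functions in `L¹ ∩ L²` are bounded functionals of the gradient alone. The bound is continuous in
the pair `p = (φ, ∇φ)` for the norm of `L² × (L²)ⁿ`, hence holds on all of `gradGraph n`. -/
theorem exists_sobolev_pairing_bound (hn : 3 ≤ n) : ∃ S : ℝ, 0 ≤ S ∧
    ∀ (w : Rn n → ℝ) (_ : MemLp w 1 volume) (h2 : MemLp w 2 volume), ∀ p ∈ gradGraph n,
      inner ℝ (h2.toLp w) p.1 ≤ S * (lpNorm w 2 volume + lpNorm w 1 volume) * ‖p.2‖ := by
  obtain ⟨A, hA⟩ := exists_sobolev_eLpNorm_mul_le hn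
  refine ⟨2 * A, by positivity, fun w h1 h2 => ?_⟩
  have hcl : IsClosed {p : L2 n × L2Vec n | inner ℝ (h2.toLp w) p.1
      ≤ 2 * A * (lpNorm w 2 volume + lpNorm w 1 volume) * ‖p.2‖} :=
    isClosed_le (by fun_prop) (by fun_prop)
  refine closure_minimal (s := (testPairs n : Set (L2 n × L2Vec n))) ?_ hcl
  rintro p ⟨φ, hφ, hp1, hp2⟩
  have n2 := lpNorm_nonneg (f := w) (p := 2) (μ := volume)
  have n1 := lpNorm_nonneg (f := w) (p := 1) (μ := volume)
  have hall := hA w φ h1 h2 hφ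
  have hp2n : eLpNorm (gradient φ) 2 volume = ENNReal.ofReal ‖p.2‖ := by
    rw [← eLpNorm_congr_ae hp2, Lp.norm_def, ENNReal.ofReal_toReal (Lp.eLpNorm_ne_top _)]
  have hinner : inner ℝ (h2.toLp w) p.1 = ∫ x, w x • φ x := by
    rw [L2.inner_def]
    refine integral_congr_ae ?_
    filter_upwards [h2.coeFn_toLp, hp1] with x hx hy
    rw [hx, hy]; simp [mul_comm]
  change inner ℝ (h2.toLp w) p.1 ≤ _
  rw [hinner]
  have hen : ‖∫ x, w x • φ x‖ₑ ≤ ENNReal.ofReal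
      (2 * A * (lpNorm w 2 volume + lpNorm w 1 volume) * ‖p.2‖) := by
    refine (enorm_integral_le_lintegral_enorm _).trans ?_
    rw [← eLpNorm_one_eq_lintegral_enorm]
    refine hall.trans (le_of_eq ?_)
    have two : ∀ y : ℝ≥0∞, 2 * y = ENNReal.ofReal 2 * y := fun y => by rw [ENNReal.ofReal_ofNat]
    rw [hp2n, two, ← ofReal_lpNorm h1, ← ofReal_lpNorm h2, ← ENNReal.ofReal_add lpNorm_nonneg
      lpNorm_nonneg,  ← ENNReal.ofReal_coe_nnreal,
      ← ENNReal.ofReal_mul (by norm_num), ← ENNReal.ofReal_mul (by positivity),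
      ← ENNReal.ofReal_mul (by positivity)]
    congr 1
    ring
  refine (le_abs_self _).trans ?_
  rw [← Real.norm_eq_abs]
  have hnn : 0 ≤ 2 * A * (lpNorm w 2 volume + lpNorm w 1 volume) * ‖p.2‖ := by
    positivity
  rwa [← ofReal_norm, ENNReal.ofReal_le_ofReal_iff hnn] at hen

/-! ### The weighted energy and the bound -/

/-- Multiplication by a bounded function, as an operator on `L²`. -/
noncomputable def mulL2 {a : Rn n → ℝ} (ha : MemLp a ∞ volume) : L2 n →L[ℝ] L2 n :=
  (ContinuousLinearMap.mul ℝ ℝ).holderL volume ∞ 2 2 (ha.toLp a)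

theorem coeFn_mulL2 {a : Rn n → ℝ} (ha : MemLp a ∞ volume) (f : L2 n) :
    mulL2 ha f =ᵐ[volume] fun x => a x * f x := by
  have h := (ContinuousLinearMap.mul ℝ ℝ).coeFn_holder (r := 2) (ha.toLp a) f
  filter_upwards [h, ha.coeFn_toLp] with x hx hy
  rw [hy] at hx
  exact hx

theorem inner_mulL2 {a : Rn n → ℝ} (ha : MemLp a ∞ volume) (f g : L2 n) :
    inner ℝ (mulL2 ha f) g = ∫ x, a x * f x * g x := by
  rw [L2.inner_def]
  refine integral_congr_ae ?_
  filter_upwards [coeFn_mulL2 ha f] with x hx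
  simp [hx, mul_comm]

theorem inner_mulL2_comm {a : Rn n → ℝ} (ha : MemLp a ∞ volume) (f g : L2 n) :
    inner ℝ (mulL2 ha f) g = inner ℝ (mulL2 ha g) f := by
  simp only [inner_mulL2, mul_right_comm]

theorem lpNorm_mul_le_of_ae_bound {a w : Rn n → ℝ} {B : ℝ} (hB : 0 ≤ B) {p : ℝ≥0∞}
    (ha : AEStronglyMeasurable a volume) (h : ∀ᵐ x, ‖a x‖ ≤ B) (hw : MemLp w p volume) :
    lpNorm (fun x => a x * w x) p volume ≤ B * lpNorm w p volume := by
  have h1 : eLpNorm (fun x => a x * w x) p volume ≤ ENNReal.ofReal B * eLpNorm w p volume := by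
    refine eLpNorm_le_mul_eLpNorm_of_ae_le_mul ?_ p
    filter_upwards [h] with x hx
    rw [norm_mul]; gcongr
  have hm : AEStronglyMeasurable (fun x => a x * w x) volume := ha.mul hw.1
  rw [← toReal_eLpNorm hm, ← toReal_eLpNorm hw.1]
  refine (ENNReal.toReal_mono (ENNReal.mul_ne_top ENNReal.ofReal_ne_top hw.2.ne) h1).trans
    (le_of_eq ?_)
  rw [ENNReal.toReal_mul, ENNReal.toReal_ofReal hB]

theorem IsWavespeed.inv_sq_memLp_top {c : Rn n → ℝ} (hc : IsWavespeed c) :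
    MemLp (fun x => (c x)⁻¹ ^ 2) ∞ volume := by
  simp only [sq]
  exact MemLp.mul (r := ∞) hc.inv_memLp_top hc.inv_memLp_top

/-- The weighted norm `‖c⁻¹ f‖` controls `‖f‖`, since `1 ≤ M / c` almost everywhere. -/
theorem IsWavespeed.norm_sq_le {c : Rn n → ℝ} (hc : IsWavespeed c) {M : ℝ}
    (hM : lpNorm c ∞ volume ≤ M) (f : L2 n) :
    ‖f‖ ^ 2 ≤ M ^ 2 * inner ℝ (mulL2 hc.inv_sq_memLp_top f) f := by
  rw [inner_mulL2, ← real_inner_self_eq_norm_sq, L2.inner_def, ← integral_const_mul]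
  have hi : Integrable (fun x => (c x)⁻¹ ^ 2 * f x * f x) volume := by
    refine (L2.integrable_inner (𝕜 := ℝ) (mulL2 hc.inv_sq_memLp_top f) f).congr ?_
    filter_upwards [coeFn_mulL2 hc.inv_sq_memLp_top f] with x hx
    rw [hx, RCLike.inner_apply, conj_trivial, mul_comm]
  refine integral_mono_ae (L2.integrable_inner f f) (hi.const_mul _) ?_
  filter_upwards [ae_le_lpNorm_exponent_top hc.memLp_top] with x hx
  have hcx := hc.pos x
  rw [Real.norm_of_nonneg hcx.le] at hx
  have h1 : 1 ≤ M * (c x)⁻¹ := by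
    rw [← div_eq_mul_inv, le_div_iff₀ hcx]; linarith
  have h2 : 1 ≤ (M * (c x)⁻¹) ^ 2 := one_le_pow₀ h1
  have h3 : inner ℝ (f x) (f x) = f x * f x := rfl
  rw [h3]
  calc f x * f x ≤ (M * (c x)⁻¹) ^ 2 * (f x * f x) :=
        le_mul_of_one_le_left (mul_self_nonneg _) h2
    _ = _ := by ring

theorem inner_mulL2_self_eq_lpNorm_sq {b u₀ : Rn n → ℝ} (hb : MemLp b ∞ volume)
    (hb2 : MemLp (fun x => b x ^ 2) ∞ volume) {f : L2 n} (hf : f =ᵐ[volume] u₀) :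
    inner ℝ (mulL2 hb2 f) f = lpNorm (fun x => b x * u₀ x) 2 volume ^ 2 := by
  have hm : MemLp (fun x => b x * u₀ x) 2 volume :=
    MemLp.mul (r := 2) ((memLp_congr_ae hf).1 (Lp.memLp f)) hb
  rw [← toReal_eLpNorm hm.1, ← Lp.norm_toLp _ hm, ← real_inner_self_eq_norm_sq, inner_mulL2,
    L2.inner_def]
  refine integral_congr_ae ?_
  filter_upwards [hf, hm.coeFn_toLp] with x hx hy
  rw [hy, hx]
  simp only [RCLike.inner_apply, conj_trivial]
  ring

/-- The conservation law for the wave equation; `p` is the pair `(v(t), ∇v(t))`, `v(t) = ∫₀ᵗ u`. -/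
theorem IsWeakSolution.exists_primitive_energy_identity {c u₀ u₁ : Rn n → ℝ} {u : ℝ → L2 n}
    (hc : IsWavespeed c) (hu : IsWeakSolution c u₀ u₁ u)
    (hw : MemLp (fun x => (c x)⁻¹ ^ 2 * u₁ x) 2 volume) {t : ℝ} (ht : 0 ≤ t) :
    ∃ p ∈ gradGraph n, inner ℝ (mulL2 hc.inv_sq_memLp_top (u t)) (u t) + ‖p.2‖ ^ 2
      = lpNorm (fun x => (c x)⁻¹ * u₀ x) 2 volume ^ 2 + 2 * inner ℝ (hw.toLp _) p.1 := by
  obtain ⟨gu, ut, -, hgu, hgrad, -, hut, h0, h1, hweak⟩ := hu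
  obtain ⟨p, hp, h⟩ := LipschitzWave.exists_primitive_energy_identity (testPairs n)
    (mulL2 hc.inv_sq_memLp_top) (inner_mulL2_comm _) hgu hut
    (fun s hs => (hgrad s hs).mem_gradGraph) (by
      rintro q ⟨φ, hφ, hq1, hq2⟩ s hs
      convert! hweak φ hφ s hs using 1
      · funext s
        rw [inner_mulL2]
        refine integral_congr_ae ?_
        filter_upwards [hq1] with x hx
        rw [hx]
      · rw [L2.inner_def]
        congr 1
        refine integral_congr_ae ?_
        filter_upwards [hq2] with x hx
        rw [hx]) ht
  refine ⟨p, hp, h.trans ?_⟩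
  have e : mulL2 hc.inv_sq_memLp_top (ut 0) = hw.toLp _ := by
    apply Lp.ext
    filter_upwards [coeFn_mulL2 hc.inv_sq_memLp_top (ut 0), hw.coeFn_toLp, h1] with x hx hy hz
    rw [hx, hy, hz]
  rw [e, inner_mulL2_self_eq_lpNorm_sq hc.inv_memLp_top hc.inv_sq_memLp_top h0]

end LipschitzWave

theorem proposition2p2 (n : ℕ) (hn : 3 ≤ n) (M : ℝ) :
    ∃ C : ℝ, 0 < C ∧
      ∀ c : LipschitzWave.Rn n → ℝ, LipschitzWave.IsWavespeed c → lpNorm c ∞ volume ≤ M →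
      ∀ u₀ u₁ : LipschitzWave.Rn n → ℝ,
        LipschitzWave.MemH1 u₀ → MemLp u₁ 2 volume → MemLp u₁ 1 volume →
      ∀ u : ℝ → LipschitzWave.L2 n, LipschitzWave.IsWeakSolution c u₀ u₁ u →
      ∀ t : ℝ, 0 ≤ t →
        ‖u t‖ ≤ C * lpNorm (fun x => (c x)⁻¹) ∞ volume ^ 2
              * (lpNorm u₁ 2 volume + lpNorm u₁ 1 volume)
            + C * lpNorm (fun x => (c x)⁻¹ * u₀ x) 2 volume := by
  obtain ⟨S, hS, hsob⟩ := LipschitzWave.exists_sobolev_pairing_bound hn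
  refine ⟨(|M| + 1) * (S + 1), by positivity, ?_⟩
  intro c hc hM u₀ u₁ _ hu2 hu1 u hu t ht
  have hM0 : 0 ≤ M := lpNorm_nonneg.trans hM
  rw [abs_of_nonneg hM0]
  have ha := hc.inv_sq_memLp_top
  set K := lpNorm (fun x => (c x)⁻¹) ∞ volume with hK
  have hK0 : 0 ≤ K := lpNorm_nonneg
  have hbd : ∀ᵐ x, ‖(c x)⁻¹ ^ 2‖ ≤ K ^ 2 := by
    filter_upwards [ae_le_lpNorm_exponent_top hc.inv_memLp_top] with x hx
    rw [norm_pow]; gcongr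
  have hw2 : MemLp (fun x => (c x)⁻¹ ^ 2 * u₁ x) 2 volume := MemLp.mul (r := 2) hu2 ha
  have hw1 : MemLp (fun x => (c x)⁻¹ ^ 2 * u₁ x) 1 volume := MemLp.mul (r := 1) hu1 ha
  have b2 := LipschitzWave.lpNorm_mul_le_of_ae_bound (sq_nonneg K) ha.1 hbd hu2
  have b1 := LipschitzWave.lpNorm_mul_le_of_ae_bound (sq_nonneg K) ha.1 hbd hu1
  obtain ⟨p, hp, hE⟩ := hu.exists_primitive_energy_identity hc hw2 ht
  have hs := hsob _ hw1 hw2 p hp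
  have hq := hc.norm_sq_le hM (u t)
  set N := lpNorm u₁ 2 volume + lpNorm u₁ 1 volume with hN
  have hN0 : 0 ≤ N := add_nonneg lpNorm_nonneg lpNorm_nonneg
  set A := lpNorm (fun x => (c x)⁻¹ * u₀ x) 2 volume with hA
  have hA0 : 0 ≤ A := lpNorm_nonneg
  have hs' : inner ℝ (hw2.toLp _) p.1 ≤ S * (K ^ 2 * N) * ‖p.2‖ := by
    refine hs.trans ?_
    gcongr
    rw [hN, mul_add]
    exact add_le_add b2 b1
  set B := S * (K ^ 2 * N) with hB
  have hB0 : 0 ≤ B := by positivity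
  -- Completing the square absorbs `‖∇v‖`.
  have hfin : inner ℝ (LipschitzWave.mulL2 hc.inv_sq_memLp_top (u t)) (u t) ≤ (A + B) ^ 2 := by
    nlinarith [sq_nonneg (‖p.2‖ - B), mul_nonneg hA0 hB0]
  have hsq : ‖u t‖ ^ 2 ≤ (M * (A + B)) ^ 2 := by
    rw [mul_pow]
    exact hq.trans (by gcongr)
  have h1 : ‖u t‖ ≤ M * (A + B) := le_of_sq_le_sq hsq (by positivity)
  have hKN : 0 ≤ K ^ 2 * N := by positivity
  calc ‖u t‖ ≤ M * (A + B) := h1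
    _ ≤ (M + 1) * ((S + 1) * A + (S + 1) * (K ^ 2 * N)) := by
        rw [hB]
        gcongr
        · linarith
        · nlinarith
        · linarith
    _ = _ := by ring
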